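/- Let $p\ge 1$ and let $\mathbf U:\mathbb Z^p\to GL_3(\mathbb Z)$ be a unipotent $\mathbb Z^p$-action on $\mathbb Z^3$, i.e. a homomorphism such that every $\mathbf U(\ell)$ is unipotent. An affine $\mathbb Z^p$-action on $T^3=\mathbb R^3/\mathbb Z^3$ with linear part $\mathbf U$ is a homomorphism $\varphi$ from $\mathbb Z^p$ to the group of affine transformations of $T^3$ with $\varphi(\ell)(\mathbf x)=\mathbf U(\ell)\mathbf x+\varphi(\ell)(0)$; it is minimal if all its orbits are dense, and free if $\varphi(\ell)$ has no fixed point for every $\ell\ne 0$. Let $\Gamma=\{k\in\mathbb Z^3:\mathbf U(\ell)^{T}k=k\text{ for all }\ell\in\mathbb Z^p\}$. The action $\varphi$ satisfies the irrationality condition on $\Gamma$ if for each $k\in\Gamma\setminus\{0\}$ there is an $\ell\in\mathbb Z^p$ with $\langle k,a\rangle\notin\mathbb Z$ for the lifts $a\in\mathbb R^3$ of $\varphi(\ell)(0)$. There are $P\in GL_3(\mathbb Z)$ and functions $\mu,\nu,\omega:\mathbb Z^p\to\mathbb Z$ such that, in the coordinates $(x,y,z)=Pv$ $(v\in\mathbb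 Z^3)$, $$\mathbf U(\ell)(x,y,z)=(x,\ \mu(\ell)x+y,\ \omega(\ell)x+\nu(\ell)y+z)\qquad(\ell\in\mathbb Z^p).$$ For all $P,\mu,\nu,\omega$ with this property: 1. $\mathbf U$ is the linear part of a minimal free affine $\mathbb Z^p$-action on $T^3$ if and only if it is not the case that $\nu=0$ and $\mu,\omega$ are linearly independent over $\mathbb Q$. 2. Suppose that $\nu=0$ and that $\mu,\omega$ are linearly independent over $\mathbb Q$, and let $\varphi$ be any affine $\mathbb Z^p$-action on $T^3$ with linear part $\mathbf U$. Then $\varphi$ does not satisfy the irrationality condition on $\Gamma$. Moreover, whenever $\varphi$ lifts to an affine $\mathbb Z^p$-action $\widetilde\varphi(\ell)(v)=\mathbf U(\ell)v+\alpha(\ell)$ on $\mathbb R^3$, the first coordinate $\alpha_1(\ell)$ of $P\alpha(\ell)$ is $0$ for all $\ell\in\mathbb Z^p$. -/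

import Mathlib

open Matrix Multiplicative

/-- The torus `T^q = ℝ^q / ℤ^q`, as the `q`-fold product of the circle `ℝ / ℤ`. -/
abbrev Torus (q : ℕ) : Type := Fin q → UnitAddCircle

/-- The covering projection `ℝ^q → T^q`. -/
def torusProj {q : ℕ} (x : Fin q → ℝ) : Torus q := fun i => (x i : UnitAddCircle)

/-- The endomorphism of `T^q` induced by an integer matrix. -/
def torusHom {q : ℕ} (M : Matrix (Fin q) (Fin q) ℤ) : Torus q →+ Torus q where
  toFun x := fun i => ∑ j, M i j • x j
  map_zero' := by
    funext i
    simp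
  map_add' x y := by
    funext i
    simp [Finset.sum_add_distrib]

theorem torusHom_apply {q : ℕ} (M : Matrix (Fin q) (Fin q) ℤ) (x : Torus q) (i : Fin q) :
    torusHom M x i = ∑ j, M i j • x j := rfl

theorem torusHom_one {q : ℕ} (x : Torus q) :
    torusHom (1 : Matrix (Fin q) (Fin q) ℤ) x = x := by
  funext i
  simp [torusHom_apply, Matrix.one_apply, ite_smul]

theorem torusHom_mul {q : ℕ} (M N : Matrix (Fin q) (Fin q) ℤ) (x : Torus q) :
    torusHom (M * N) x = torusHom M (torusHom N x) := by
  funext i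
  simp only [torusHom_apply, Matrix.mul_apply, Finset.sum_smul, Finset.smul_sum, mul_smul]
  exact Finset.sum_comm

/-- The group `Affine(T^q)` of affine transformations `x ↦ M x + a` of the torus, with
`M ∈ GL_q(ℤ)` and `a ∈ T^q`, as a group of homeomorphisms. -/
def affineGroup (q : ℕ) : Subgroup (Torus q ≃ₜ Torus q) where
  carrier := {f | ∃ (M : GL (Fin q) ℤ) (a : Torus q), ∀ x, f x = torusHom M.val x + a}
  one_mem' := ⟨1, 0, fun x => by simp [torusHom_one]⟩
  mul_mem' := by
    rintro f g ⟨M, a, hf⟩ ⟨N, b, hg⟩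
    refine ⟨M * N, torusHom M.val b + a, fun x => ?_⟩
    rw [Homeomorph.mul_apply, hf, hg, map_add, Units.val_mul, torusHom_mul, add_assoc]
  inv_mem' := by
    rintro f ⟨M, a, hf⟩
    refine ⟨M⁻¹, -torusHom (M⁻¹).val a, fun x => f.injective ?_⟩
    have h : f (f⁻¹ x) = x := f.apply_symm_apply x
    rw [h, hf, map_add, map_neg, ← torusHom_mul, ← torusHom_mul, ← Units.val_mul,
      mul_inv_cancel, Units.val_one, torusHom_one, torusHom_one, neg_add_cancel_right]

/-- A `ℤ^p`-action on `ℤ^q` by automorphisms. -/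
abbrev LatticeAction (p q : ℕ) : Type := Multiplicative (Fin p → ℤ) →* GL (Fin q) ℤ

/-- An affine `ℤ^p`-action on `T^q`. -/
abbrev AffineAction (p q : ℕ) : Type := Multiplicative (Fin p → ℤ) →* affineGroup q

/-- The transformation `φ(ℓ)` of the torus. -/
def AffineAction.act {p q : ℕ} (φ : AffineAction p q) (l : Fin p → ℤ) (x : Torus q) : Torus q :=
  (φ (ofAdd l)).val x

/-- The integer matrix of `A(ℓ)`. -/
def LatticeAction.mat {p q : ℕ} (A : LatticeAction p q) (l : Fin p → ℤ) :
    Matrix (Fin q) (Fin q) ℤ :=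
  (A (ofAdd l)).val

/-- All the automorphisms `U(ℓ)` are unipotent. -/
def LatticeAction.IsUnipotent {p q : ℕ} (U : LatticeAction p q) : Prop :=
  ∀ l, IsNilpotent (U.mat l - 1)

/-- `A` is the linear part of `φ`: `φ(ℓ)(x) = A(ℓ) x + α(ℓ)`, where `α(ℓ) = φ(ℓ)(0)`. -/
def AffineAction.HasLinearPart {p q : ℕ} (φ : AffineAction p q) (A : LatticeAction p q) : Prop :=
  ∀ l x, φ.act l x = torusHom (A.mat l) x + φ.act l 0

/-- Only the identity of `ℤ^p` acts with a fixed point. -/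
def AffineAction.IsFree {p q : ℕ} (φ : AffineAction p q) : Prop :=
  ∀ l, l ≠ 0 → ∀ x, φ.act l x ≠ x

/-- Every orbit is dense. -/
def AffineAction.IsMinimal {p q : ℕ} (φ : AffineAction p q) : Prop :=
  ∀ x, Dense (Set.range fun l => φ.act l x)

/-- `A` is the linear part of a minimal free affine action. -/
def LatticeAction.IsLinearPartOfMinimalFree {p q : ℕ} (A : LatticeAction p q) : Prop :=
  ∃ φ : AffineAction p q, φ.HasLinearPart A ∧ φ.IsMinimal ∧ φ.IsFree

/-- The fixed vectors of the dual action on `H¹(T^q, ℤ) = ℤ^q`, where `ℓ` acts by the transpose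
of `A(ℓ)`. -/
def LatticeAction.dualFix {p q : ℕ} (A : LatticeAction p q) : Set (Fin q → ℤ) :=
  {k | ∀ l, (A.mat l)ᵀ *ᵥ k = k}

/-- The irrationality condition for an affine action `φ` with linear part `A`: for each nonzero
`k` fixed by the dual action, some `ℓ` has `⟨k, a⟩ ∉ ℤ` for the lifts `x ↦ A(ℓ) x + a` of `φ(ℓ)`
to `ℝ^q`. -/
def AffineAction.Irrationality {p q : ℕ} (φ : AffineAction p q) (A : LatticeAction p q) : Prop :=
  ∀ k ∈ A.dualFix, k ≠ 0 → ∃ l, ∀ a : Fin q → ℝ, torusProj a = φ.act l 0 →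
    ∀ n : ℤ, ∑ i, (k i : ℝ) * a i ≠ n

/-- The transformations `x ↦ A(ℓ) x + α(ℓ)` form an affine `ℤ^p`-action on `ℝ^q` that lifts the
action `φ` on `T^q`. -/
def AffineAction.LiftsTo {p q : ℕ} (φ : AffineAction p q) (A : LatticeAction p q)
    (α : (Fin p → ℤ) → Fin q → ℝ) : Prop :=
  (∀ l l', α (l + l') = (A.mat l).map (Int.cast : ℤ → ℝ) *ᵥ α l' + α l) ∧
  ∀ l x, φ.act l (torusProj x) =
    torusProj ((A.mat l).map (Int.cast : ℤ → ℝ) *ᵥ x + α l)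

/-- In the coordinates `(x, y, z) = P v` on `ℤ³`, the automorphism `U(ℓ)` reads
`(x, y, z) ↦ (x, μ(ℓ) x + y, ω(ℓ) x + ν(ℓ) y + z)`. -/
def LatticeAction.HasNormalForm {p : ℕ} (U : LatticeAction p 3) (P : GL (Fin 3) ℤ)
    (μ ν ω : (Fin p → ℤ) → ℤ) : Prop :=
  ∀ l, P.val * U.mat l * (P⁻¹).val = !![1, 0, 0; μ l, 1, 0; ω l, ν l, 1]

/-- The exceptional subcase of Case I: `ν = 0`, and `μ`, `ω` are linearly independent over `ℚ`. -/
def IsExceptional {p : ℕ} (μ ν ω : (Fin p → ℤ) → ℤ) : Prop :=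
  ν = 0 ∧ LinearIndependent ℚ ![fun l => (μ l : ℚ), fun l => (ω l : ℚ)]

/-! Normal form: the operators `U(ℓ)ᵀ - 1` on the dual lattice commute and are nilpotent, so they
have a common nonzero kernel vector. Made primitive, it is an invariant surjection `χ : V → ℤ`;
splitting off a vector with `χ = 1` and inducting on `ker χ` gives a lower unitriangular basis
(`exists_basis_unitriangular`).

Obstruction: write the translation part of an action in the coordinates `P` as `(a, b, c)`. If `ν =
0`, then `b (l + l') = μ l • a l' + b l' + b l`, and likewise for `c` with `ω`. As `l + l' = l' +
l`, it follows that `μ l • a l' = μ l' • a l` and `ω l • a l' = ω l' • a l`. If `μ, ω` are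
independent, some `μ l * ω l' - μ l' * ω l` is nonzero and a single integer `N ≠ 0` kills every `a
l` (`exists_zsmul_eq_zero_of_symm`). Over `ℝ` this forces `a = 0`; on the torus it confines the
orbit of `0` to a proper closed set and makes the character `N • x` violate irrationality.

Construction: otherwise `μ, ω` (if `ν = 0`) or `μ, ν` (if `ν ≠ 0`, by commutativity) are multiples
of one primitive functional `m`, and a real cocycle can be written down as a polynomial in `m`, with
rationally independent coefficients. At `l₀` with `m l₀ = 1` the numbers `1, a, b, c` are rationally
independent, so by Weyl equidistribution (`denseRange_unipotent_orbit`) the single map `φ(l₀)`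
already has only dense orbits. Freeness is read off one coordinate at a time. -/

/-! ### Weyl equidistribution for unipotent affine maps -/

-- Van der Corput's inequality. Averaging over `H` shifts changes `H * ∑ u n` by at most `2 * H ^
-- 2`; Cauchy–Schwarz then bounds the averaged sum by correlations, of which only the `H` diagonal
-- ones survive in the limit.
open Filter Topology in
theorem tendsto_average_of_correlations {u : ℕ → ℂ} (hu : ∀ n, ‖u n‖ ≤ 1)
    (h : ∀ a b, a ≠ b → Tendsto (fun N : ℕ =>
      (∑ n ∈ Finset.range N, u (n + a) * (starRingEnd ℂ) (u (n + b))) / (N : ℂ)) atTop (𝓝 0)) :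
    Tendsto (fun N : ℕ => (∑ n ∈ Finset.range N, u n) / (N : ℂ)) atTop (𝓝 0) := by
  have shift : ∀ a N : ℕ, ‖∑ n ∈ Finset.range N, u (n + a) - ∑ n ∈ Finset.range N, u n‖
      ≤ 2 * a := by
    intro a N
    have e : ∑ n ∈ Finset.range N, u (n + a) - ∑ n ∈ Finset.range N, u n
        = ∑ n ∈ Finset.range a, u (N + n) - ∑ n ∈ Finset.range a, u n := by
      have h1 := Finset.sum_range_add u N a
      have h2 := Finset.sum_range_add u a N
      simp only [add_comm a] at h2
      rw [h1] at h2
      linear_combination -h2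
    rw [e]
    refine (norm_sub_le _ _).trans ?_
    have b : ∀ v : ℕ → ℂ, (∀ n, ‖v n‖ ≤ 1) → ‖∑ n ∈ Finset.range a, v n‖ ≤ a := fun v hv =>
      (norm_sum_le_of_le _ fun n _ => hv n).trans (by simp)
    linarith [b u hu, b (fun n => u (N + n)) fun n => hu _]
  have key : ∀ H N : ℕ, 0 < N → ‖(H : ℂ) * ∑ n ∈ Finset.range N, u n‖ ≤
      2 * (H : ℝ) ^ 2 + √(N * ‖∑ a ∈ Finset.range H, ∑ b ∈ Finset.range H,
        ∑ n ∈ Finset.range N, u (n + a) * (starRingEnd ℂ) (u (n + b))‖) := by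
    intro H N _
    have e1 : ‖(H : ℂ) * ∑ n ∈ Finset.range N, u n
        - ∑ n ∈ Finset.range N, ∑ a ∈ Finset.range H, u (n + a)‖ ≤ 2 * (H : ℝ) ^ 2 := by
      rw [Finset.sum_comm, norm_sub_rev]
      have : (H : ℂ) * ∑ n ∈ Finset.range N, u n
          = ∑ a ∈ Finset.range H, ∑ n ∈ Finset.range N, u n := by simp
      rw [this, ← Finset.sum_sub_distrib]
      refine (norm_sum_le_of_le _ (fun a ha => (shift a N).trans
        (?_ : (2 * a : ℝ) ≤ 2 * H))).trans ?_
      · have : (a : ℝ) ≤ H := by exact_mod_cast (Finset.mem_range.mp ha).le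
        linarith
      · simp; nlinarith
    have e2 : ‖∑ n ∈ Finset.range N, ∑ a ∈ Finset.range H, u (n + a)‖ ≤
        √(N * ‖∑ a ∈ Finset.range H, ∑ b ∈ Finset.range H,
          ∑ n ∈ Finset.range N, u (n + a) * (starRingEnd ℂ) (u (n + b))‖) := by
      apply Real.le_sqrt_of_sq_le
      have c : ∑ a ∈ Finset.range H, ∑ b ∈ Finset.range H,
          ∑ n ∈ Finset.range N, u (n + a) * (starRingEnd ℂ) (u (n + b))
          = ((∑ n ∈ Finset.range N, ‖∑ a ∈ Finset.range H, u (n + a)‖ ^ 2 : ℝ) : ℂ) := by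
        push_cast
        simp_rw [← Complex.mul_conj', map_sum, Finset.sum_mul_sum]
        rw [Finset.sum_comm]
        rw [Finset.sum_congr rfl fun b _ => Finset.sum_comm]
        rw [Finset.sum_comm]
        refine Finset.sum_congr rfl fun n _ => ?_
        rw [Finset.sum_comm]
      rw [c, Complex.norm_real, Real.norm_of_nonneg (by positivity)]
      calc ‖∑ n ∈ Finset.range N, ∑ a ∈ Finset.range H, u (n + a)‖ ^ 2
          ≤ (∑ n ∈ Finset.range N, ‖∑ a ∈ Finset.range H, u (n + a)‖) ^ 2 := by
            gcongr; exact norm_sum_le _ _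
        _ ≤ _ := by simpa using sq_sum_le_card_mul_sum_sq (s := Finset.range N)
                      (f := fun n => ‖∑ a ∈ Finset.range H, u (n + a)‖)
    have := norm_add_le ((H : ℂ) * ∑ n ∈ Finset.range N, u n
        - ∑ n ∈ Finset.range N, ∑ a ∈ Finset.range H, u (n + a))
        (∑ n ∈ Finset.range N, ∑ a ∈ Finset.range H, u (n + a))
    rw [sub_add_cancel] at this
    linarith
  have lim : ∀ H : ℕ, ∀ᶠ N : ℕ in atTop, ‖(∑ a ∈ Finset.range H, ∑ b ∈ Finset.range H,
        ∑ n ∈ Finset.range N, u (n + a) * (starRingEnd ℂ) (u (n + b))) / (N : ℂ)‖ ≤ H + 1 := by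
    intro H
    have t : Tendsto (fun N : ℕ => ∑ a ∈ Finset.range H, ∑ b ∈ (Finset.range H).erase a,
        (∑ n ∈ Finset.range N, u (n + a) * (starRingEnd ℂ) (u (n + b))) / (N : ℂ))
        atTop (𝓝 0) := by
      have := tendsto_finsetSum (Finset.range H) (fun a _ =>
        tendsto_finsetSum ((Finset.range H).erase a) (fun b hb =>
          h a b (Finset.ne_of_mem_erase hb).symm))
      simpa using this
    filter_upwards [(tendsto_zero_iff_norm_tendsto_zero.mp t).eventually_le_const zero_lt_one,
      eventually_gt_atTop 0] with N hN hN0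
    have hN0' : (0 : ℝ) < N := by exact_mod_cast hN0
    have d : (∑ a ∈ Finset.range H, ∑ b ∈ Finset.range H,
        ∑ n ∈ Finset.range N, u (n + a) * (starRingEnd ℂ) (u (n + b))) / (N : ℂ)
        = ∑ a ∈ Finset.range H,
          (∑ n ∈ Finset.range N, u (n + a) * (starRingEnd ℂ) (u (n + a))) / (N : ℂ)
        + ∑ a ∈ Finset.range H, ∑ b ∈ (Finset.range H).erase a,
        (∑ n ∈ Finset.range N, u (n + a) * (starRingEnd ℂ) (u (n + b))) / (N : ℂ) := by
      simp_rw [Finset.sum_div]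
      rw [← Finset.sum_add_distrib]
      refine Finset.sum_congr rfl fun a ha => ?_
      exact (Finset.add_sum_erase _ (fun b =>
        ∑ n ∈ Finset.range N, u (n + a) * (starRingEnd ℂ) (u (n + b)) / (N : ℂ)) ha).symm
    rw [d]
    refine (norm_add_le _ _).trans (add_le_add ?_ hN)
    refine (norm_sum_le_of_le (n := fun _ => (1 : ℝ)) _ fun a _ => ?_).trans (by simp)
    rw [norm_div, Complex.norm_natCast, div_le_one hN0']
    refine (norm_sum_le_of_le (n := fun _ => (1 : ℝ)) _ fun n _ => ?_).trans (by simp)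
    rw [norm_mul, RCLike.norm_conj]
    exact mul_le_one₀ (hu _) (norm_nonneg _) (hu _)
  rw [Metric.tendsto_atTop']
  intro ε hε
  -- After division by `H * N`, `key` and `lim` leave `2 * H / N + √(H + 1) / H`. As `H + 1 < 2 *
  -- H`, the bound `H > 8 / ε ^ 2` makes the second term less than `ε / 2`; `N > M > 4 * H / ε` does
  -- so for the first.
  obtain ⟨H, hH⟩ := exists_nat_gt (max 1 (8 / ε ^ 2))
  have hH1 : 1 < (H : ℝ) := (le_max_left _ _).trans_lt hH
  have hH2 : 8 / ε ^ 2 < H := (le_max_right _ _).trans_lt hH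
  obtain ⟨M, hM⟩ := exists_nat_gt (4 * H / ε)
  obtain ⟨N0, hN0⟩ := eventually_atTop.mp (lim H)
  refine ⟨max N0 M, fun N hN => ?_⟩
  have hN' : (M : ℝ) < N := by exact_mod_cast (le_max_right _ _).trans_lt hN
  have hNpos : (0 : ℝ) < N := (Nat.cast_nonneg _).trans_lt hN'
  have l := hN0 N ((le_max_left _ _).trans hN.le)
  rw [norm_div, Complex.norm_natCast, div_le_iff₀ hNpos] at l
  have k := key H N (by exact_mod_cast hNpos)
  rw [norm_mul, Complex.norm_natCast] at k
  rw [dist_zero_right, norm_div, Complex.norm_natCast, div_lt_iff₀ hNpos]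
  have s : √(N * ‖∑ a ∈ Finset.range H, ∑ b ∈ Finset.range H,
        ∑ n ∈ Finset.range N, u (n + a) * (starRingEnd ℂ) (u (n + b))‖) < ε / 2 * (H * N) := by
    rw [Real.sqrt_lt' (by positivity)]
    rw [div_lt_iff₀ (by positivity)] at hH2
    calc (N : ℝ) * ‖_‖ ≤ N * ((H + 1) * N) := by gcongr
      _ < (ε / 2 * (H * N)) ^ 2 := by
        have : (H : ℝ) + 1 < ε ^ 2 / 4 * H ^ 2 := by nlinarith
        have := mul_lt_mul_of_pos_right this (pow_pos hNpos 2)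
        linarith
  have s2 : 2 * (H : ℝ) ^ 2 < ε / 2 * (H * N) := by
    rw [div_lt_iff₀ hε] at hM
    have : 4 * (H : ℝ) < N * ε := by nlinarith
    nlinarith
  have : (H : ℝ) * ‖∑ n ∈ Finset.range N, u n‖ < H * (ε * N) := by linarith
  exact lt_of_mul_lt_mul_left this (by positivity)

-- Here `u` is a polynomial phase of degree `d + 1` with `θ` as its top difference. Passing to `u (n
-- + a) - u (n + b)` lowers the degree and replaces `θ` by `(a - b) • θ`, again of infinite order,
-- so van der Corput gives the induction; the base case is a bounded geometric sum.
open Filter Topology in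
theorem tendsto_average_fourier_one {θ : UnitAddCircle} (hθ : ∀ k : ℤ, k ≠ 0 → k • θ ≠ 0) (d : ℕ)
    {u : ℕ → UnitAddCircle} (hu : ∀ n, (fwdDiff 1)^[d + 1] u n = θ) :
    Tendsto (fun N : ℕ => (∑ n ∈ Finset.range N, fourier 1 (u n)) / (N : ℂ))
      atTop (𝓝 0) := by
  induction d generalizing θ u with
  | zero =>
    have hn : ∀ n, u n = u 0 + n • θ := by
      intro n
      induction n with
      | zero => simp
      | succ n ih =>
        have := hu n
        simp only [zero_add, Function.iterate_one, fwdDiff] at this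
        rw [add_smul, one_smul, ← add_assoc, ← ih, ← this]; abel
    set z : ℂ := fourier 1 θ with hz
    have hz1 : z ≠ 1 := by
      intro h
      rw [hz, fourier_one, ← Circle.coe_one, Circle.coe_inj, ← AddCircle.toCircle_zero] at h
      have := AddCircle.injective_toCircle one_ne_zero h
      exact hθ 1 one_ne_zero (by simp [this])
    have hsum : ∀ N : ℕ, ∑ n ∈ Finset.range N, fourier 1 (u n)
        = fourier 1 (u 0) * ((z ^ N - 1) / (z - 1)) := by
      intro N
      rw [← geom_sum_eq hz1, Finset.mul_sum]
      refine Finset.sum_congr rfl fun n _ => ?_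
      rw [hn n, fourier_one, AddCircle.toCircle_add, AddCircle.toCircle_nsmul, hz, fourier_one,
        fourier_one, Circle.coe_mul, Circle.coe_pow]
    have hnz : ‖z‖ = 1 := by rw [hz, fourier_one, Circle.norm_coe]
    refine squeeze_zero_norm (a := fun N : ℕ => (2 / ‖z - 1‖) / N) (fun N => ?_)
      (tendsto_const_div_atTop_nhds_zero_nat _)
    rw [hsum, norm_div, norm_mul, norm_div, fourier_one, Circle.norm_coe, one_mul,
      Complex.norm_natCast]
    gcongr
    refine (norm_sub_le _ _).trans ?_
    rw [norm_pow, hnz]; norm_num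
  | succ d ih =>
    apply tendsto_average_of_correlations (fun n => by rw [fourier_one, Circle.norm_coe])
    intro a b hab
    have hstep : ∀ n, (fwdDiff 1)^[d + 1] u n = (fwdDiff 1)^[d + 1] u 0 + n • θ := by
      intro n
      induction n with
      | zero => simp
      | succ n ih =>
        have := hu n
        rw [Function.iterate_succ_apply', fwdDiff] at this
        rw [add_smul, one_smul, ← add_assoc, ← ih, ← this]; abel
    have hw : ∀ n, (fwdDiff 1)^[d + 1] (fun n => u (n + a) - u (n + b)) n = ((a : ℤ) - b) • θ := by
      intro n
      have e : (fun n => u (n + a) - u (n + b))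
          = (fun n => u (n + a)) + (-1 : ℤ) • fun n => u (n + b) := by
        funext n; simp [sub_eq_add_neg]
      rw [e, fwdDiff_iter_add, fwdDiff_iter_const_smul]
      simp only [Pi.add_apply, Pi.smul_apply]
      rw [fwdDiff_iter_comp_add, fwdDiff_iter_comp_add, hstep (n + a), hstep (n + b)]
      module
    have := ih (θ := ((a : ℤ) - b) • θ) (fun k hk => by
      rw [← mul_smul]
      exact hθ _ (mul_ne_zero hk (sub_ne_zero.mpr (by exact_mod_cast hab)))) hw
    refine this.congr fun N => ?_
    congr 1
    refine Finset.sum_congr rfl fun n _ => ?_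
    simp only [fourier_one]
    rw [sub_eq_add_neg, AddCircle.toCircle_add, AddCircle.toCircle_neg, Circle.coe_mul,
      Circle.coe_inv_eq_conj]

open Filter Topology MeasureTheory in
theorem integral_mFourier_eq_zero {d : Type*} [Fintype d] {k : d → ℤ} (hk : k ≠ 0) :
    ∫ x : UnitAddTorus d, UnitAddTorus.mFourier k x = 0 := by
  classical
  obtain ⟨i, hi⟩ := Function.ne_iff.mp hk
  have hadd : ∀ x y : UnitAddTorus d, UnitAddTorus.mFourier k (x + y) =
      UnitAddTorus.mFourier k x * UnitAddTorus.mFourier k y := by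
    intro x y
    simp only [UnitAddTorus.mFourier, ContinuousMap.coe_mk, Pi.add_apply, fourier_apply,
      smul_add, AddCircle.toCircle_add, Circle.coe_mul, Finset.prod_mul_distrib]
  obtain ⟨t, ht⟩ : ∃ t : UnitAddTorus d, UnitAddTorus.mFourier k t ≠ 1 := by
    -- The character takes the value `-1` at this translation, and translation invariance of Haar
    -- measure then kills the integral.
    refine ⟨Pi.single i ((1 / 2 / k i : ℝ) : UnitAddCircle), ?_⟩
    simp only [UnitAddTorus.mFourier, ContinuousMap.coe_mk]
    rw [Finset.prod_eq_single i (fun j _ hj => by simp [Pi.single_eq_of_ne hj]) (by simp)]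
    rw [Pi.single_eq_same, fourier_apply, ← AddCircle.coe_zsmul, AddCircle.toCircle_apply_mk]
    have hi' : (k i : ℝ) ≠ 0 := by exact_mod_cast hi
    have : 2 * Real.pi / 1 * (k i • (1 / 2 / (k i : ℝ))) = Real.pi := by
      rw [zsmul_eq_mul]; field_simp
    rw [this]
    norm_num [Circle.coe_exp]
  have h := integral_add_right_eq_self (μ := (volume : Measure (UnitAddTorus d)))
    (fun x => UnitAddTorus.mFourier k x) t
  simp_rw [hadd] at h
  rw [integral_mul_const] at h
  have : (∫ x : UnitAddTorus d, UnitAddTorus.mFourier k x) *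
      (UnitAddTorus.mFourier k t - 1) = 0 := by rw [mul_sub, h]; ring
  exact (mul_eq_zero.mp this).resolve_right (sub_ne_zero.mpr ht)

-- Weyl's criterion: trigonometric polynomials are uniformly dense, and averages and integral are
-- both contractions for the sup norm.
open Filter Topology MeasureTheory in
theorem tendsto_average_continuous {d : Type*} [Fintype d] {v : ℕ → UnitAddTorus d}
    (hv : ∀ k : d → ℤ, k ≠ 0 → Tendsto (fun N : ℕ =>
      (∑ n ∈ Finset.range N, UnitAddTorus.mFourier k (v n)) / (N : ℂ)) atTop (𝓝 0))
    (f : C(UnitAddTorus d, ℂ)) :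
    Tendsto (fun N : ℕ => (∑ n ∈ Finset.range N, f (v n)) / (N : ℂ)) atTop
      (𝓝 (∫ x, f x)) := by
  have : IsProbabilityMeasure (volume : Measure UnitAddCircle) := ⟨UnitAddCircle.measure_univ⟩
  have hint : ∀ f : C(UnitAddTorus d, ℂ), Integrable f (volume : Measure (UnitAddTorus d)) :=
    fun f => f.continuous.integrable_of_hasCompactSupport (HasCompactSupport.of_compactSpace f)
  have avg : ∀ (N : ℕ) (f : C(UnitAddTorus d, ℂ)),
      ‖(∑ n ∈ Finset.range N, f (v n)) / (N : ℂ)‖ ≤ ‖f‖ := by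
    intro N f
    rw [norm_div, Complex.norm_natCast]
    refine div_le_of_le_mul₀ (Nat.cast_nonneg _) (norm_nonneg _) ?_
    exact (norm_sum_le_of_le _ fun n _ => f.norm_coe_le_norm _).trans (by simp [mul_comm])
  have hmem : f ∈ closure
      ((Submodule.span ℂ (Set.range (UnitAddTorus.mFourier (d := d))) :
        Submodule ℂ C(UnitAddTorus d, ℂ)) : Set C(UnitAddTorus d, ℂ)) := by
    rw [← Submodule.topologicalClosure_coe, UnitAddTorus.span_mFourier_closure_eq_top]
    trivial
  rw [Metric.tendsto_atTop']
  intro ε hε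
  obtain ⟨g, hg, hfg⟩ := Metric.mem_closure_iff.mp hmem (ε / 3) (by positivity)
  have hgt : Tendsto (fun N : ℕ => (∑ n ∈ Finset.range N, g (v n)) / (N : ℂ)) atTop
      (𝓝 (∫ x, g x)) := by
    refine Submodule.span_induction ?_ ?_ ?_ ?_ hg
    · rintro _ ⟨k, rfl⟩
      by_cases hk : k = 0
      · subst hk
        simp only [UnitAddTorus.mFourier_zero, ContinuousMap.one_apply, integral_const]
        refine (tendsto_congr' ?_).mpr (tendsto_const_nhds)
        filter_upwards [eventually_gt_atTop 0] with N hN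
        have : (N : ℂ) ≠ 0 := by exact_mod_cast hN.ne'
        simp [this]
      · rw [integral_mFourier_eq_zero hk]; exact hv k hk
    · simp
    · intro a b _ _ ha hb
      simp only [ContinuousMap.add_apply]
      rw [integral_add (hint a) (hint b)]
      refine (ha.add hb).congr fun N => ?_
      rw [Finset.sum_add_distrib, add_div]
    · intro c a _ ha
      simp only [ContinuousMap.smul_apply]
      rw [integral_smul]
      refine (ha.const_smul c).congr fun N => ?_
      rw [← Finset.smul_sum, smul_eq_mul, smul_eq_mul, mul_div_assoc]
  obtain ⟨M, hM⟩ := Metric.tendsto_atTop'.mp hgt (ε / 3) (by positivity)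
  refine ⟨M, fun N hN => ?_⟩
  have h1 := hM N hN
  have h2 := avg N (f - g)
  rw [dist_eq_norm] at hfg h1 ⊢
  have h3 : ‖∫ x, (g - f) x‖ ≤ ‖f - g‖ := by
    refine (norm_integral_le_of_norm_le_const
      (ae_of_all _ fun x => (g - f).norm_coe_le_norm x)).trans ?_
    rw [norm_sub_rev]
    simp
  simp only [ContinuousMap.sub_apply] at h2 h3
  rw [integral_sub (hint g) (hint f)] at h3
  rw [Finset.sum_sub_distrib, sub_div] at h2
  have := norm_add₃_le (a := (∑ n ∈ Finset.range N, f (v n)) / (N : ℂ)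
      - (∑ n ∈ Finset.range N, g (v n)) / (N : ℂ))
    (b := (∑ n ∈ Finset.range N, g (v n)) / (N : ℂ) - ∫ x, g x)
    (c := (∫ x, g x) - ∫ x, f x)
  rw [sub_add_sub_cancel, sub_add_sub_cancel] at this
  linarith

-- A Urysohn function vanishing on the closure of the sequence and equal to `1` at a missed point
-- would have zero averages but positive integral.
open Filter Topology MeasureTheory in
theorem denseRange_of_tendsto_average {d : Type*} [Fintype d] {v : ℕ → UnitAddTorus d}
    (hv : ∀ k : d → ℤ, k ≠ 0 → Tendsto (fun N : ℕ =>
      (∑ n ∈ Finset.range N, UnitAddTorus.mFourier k (v n)) / (N : ℂ)) atTop (𝓝 0)) :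
    DenseRange v := by
  intro c
  by_contra hc
  obtain ⟨f, hf0, hf1, hf⟩ := exists_continuous_zero_one_of_isClosed
    (isClosed_closure (s := Set.range v)) (isClosed_singleton (x := c))
    (Set.disjoint_singleton_right.mpr hc)
  let F : C(UnitAddTorus d, ℂ) := ⟨fun x => (f x : ℂ), by fun_prop⟩
  have h1 := tendsto_average_continuous hv F
  have h2 : ∀ n, F (v n) = 0 := fun n => by
    have : f (v n) = 0 := hf0 (subset_closure (Set.mem_range_self n))
    simp [F, this]
  simp only [h2, Finset.sum_const_zero, zero_div] at h1
  have h3 : ∫ x, F x = 0 := (tendsto_nhds_unique h1 tendsto_const_nhds)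
  have h4 : ∫ x, f x = 0 := by
    have : ∫ x, F x = ((∫ x, f x : ℝ) : ℂ) := integral_ofReal
    rw [this] at h3
    exact_mod_cast h3
  have h5 : 0 < ∫ x, f x := by
    refine f.continuous.integral_pos_of_hasCompactSupport_nonneg_nonzero
      (HasCompactSupport.of_compactSpace f) (fun x => (hf x).1) (x := c) ?_
    rw [hf1 rfl]; simp
  exact h5.ne' h4

theorem mFourier_eq_fourier_one {d : Type*} [Fintype d] (k : d → ℤ) (x : UnitAddTorus d) :
    UnitAddTorus.mFourier k x = fourier 1 (∑ i, k i • x i) := by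
  classical
  have h : ∀ s : Finset d, ∏ i ∈ s, (fourier (k i) (x i) : ℂ) = fourier 1 (∑ i ∈ s, k i • x i) := by
    intro s
    induction s using Finset.induction_on with
    | empty => simp
    | insert i s hi ih =>
      rw [Finset.prod_insert hi, Finset.sum_insert hi, ih, fourier_one, fourier_one,
        AddCircle.toCircle_add, Circle.coe_mul, fourier_apply]
  exact h Finset.univ

/-- Along an orbit every character has a polynomial phase of degree at most three. Its last
nonvanishing difference is a nontrivial integer combination of the coordinates of `a`, hence of
infinite order. The starting point is arbitrary, which is what minimality requires. -/
theorem denseRange_unipotent_orbit {A B C : ℤ} {a : Torus 3}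
    (ha : ∀ k : Fin 3 → ℤ, k ≠ 0 → k 0 • a 0 + k 1 • a 1 + k 2 • a 2 ≠ 0) {v : ℕ → Torus 3}
    (hv : ∀ n, v (n + 1) = torusHom !![1, 0, 0; A, 1, 0; C, B, 1] (v n) + a) :
    DenseRange v := by
  refine denseRange_of_tendsto_average (v := v) fun k hk => ?_
  have v0 : ∀ n, v (n + 1) 0 = v n 0 + a 0 := fun n => by
    rw [hv, Pi.add_apply, torusHom_apply]; simp [Fin.sum_univ_three]
  have v1 : ∀ n, v (n + 1) 1 = A • v n 0 + v n 1 + a 1 := fun n => by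
    rw [hv, Pi.add_apply, torusHom_apply]; simp [Fin.sum_univ_three]
  have v2 : ∀ n, v (n + 1) 2 = C • v n 0 + B • v n 1 + v n 2 + a 2 := fun n => by
    rw [hv, Pi.add_apply, torusHom_apply]; simp [Fin.sum_univ_three]
  simp_rw [mFourier_eq_fourier_one, Fin.sum_univ_three]
  have order : ∀ x y z : ℤ, (x ≠ 0 ∨ y ≠ 0 ∨ z ≠ 0) → ∀ j : ℤ, j ≠ 0 →
      j • (x • a 0 + y • a 1 + z • a 2) ≠ 0 := by
    intro x y z hxyz j hj
    have := ha ![j * x, j * y, j * z] (fun h => by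
      have e0 := congrFun h 0
      have e1 := congrFun h 1
      have e2 := congrFun h 2
      simp [hj] at e0 e1 e2
      tauto)
    simpa [smul_add, mul_smul] using this
  have d1 : ∀ n, fwdDiff 1 (fun n => k 0 • v n 0 + k 1 • v n 1 + k 2 • v n 2) n =
      k 0 • a 0 + k 1 • a 1 + k 2 • a 2 + (k 1 * A + k 2 * C) • v n 0 + (k 2 * B) • v n 1 := by
    intro n
    simp only [fwdDiff, v0, v1, v2]
    module
  have d2 : ∀ n, fwdDiff 1 (fwdDiff 1 (fun n => k 0 • v n 0 + k 1 • v n 1 + k 2 • v n 2)) n =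
      (k 1 * A + k 2 * C) • a 0 + (k 2 * B) • a 1 + (k 2 * B * A) • v n 0 := by
    intro n
    rw [fwdDiff, d1, d1, v0, v1]
    module
  have d3 : ∀ n, fwdDiff 1 (fwdDiff 1
      (fwdDiff 1 (fun n => k 0 • v n 0 + k 1 • v n 1 + k 2 • v n 2))) n =
      (k 2 * B * A) • a 0 := by
    intro n
    rw [fwdDiff, d2, d2, v0]
    module
  -- The case split finds the exact degree of the phase: three, or one, or two.
  by_cases h3 : k 2 * B * A = 0
  · by_cases h2 : k 1 * A + k 2 * C = 0 ∧ k 2 * B = 0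
    · refine tendsto_average_fourier_one (θ := k 0 • a 0 + k 1 • a 1 + k 2 • a 2)
        (order _ _ _ ?_) 0 fun n => ?_
      · by_contra! h
        exact hk (by funext i; fin_cases i <;> simp [h])
      · rw [Function.iterate_one, d1, h2.1, h2.2]; simp
    · refine tendsto_average_fourier_one
        (θ := (k 1 * A + k 2 * C) • a 0 + (k 2 * B) • a 1 + (0 : ℤ) • a 2)
        (order _ _ _ (by tauto)) 1 fun n => ?_
      rw [Function.iterate_succ_apply', Function.iterate_one, d2, h3]; simp
  · refine tendsto_average_fourier_one
      (θ := (k 2 * B * A) • a 0 + (0 : ℤ) • a 1 + (0 : ℤ) • a 2)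
      (order _ _ _ (by tauto)) 2 fun n => ?_
    rw [Function.iterate_succ_apply', Function.iterate_succ_apply', Function.iterate_one, d3]
    simp

/-! ### Affine actions from cocycles, in normal-form coordinates -/

theorem continuous_torusHom {q : ℕ} (M : Matrix (Fin q) (Fin q) ℤ) :
    Continuous (torusHom M) := by
  refine continuous_pi fun i => ?_
  simp only [torusHom_apply]
  fun_prop

theorem torusHom_torusProj {q : ℕ} (M : Matrix (Fin q) (Fin q) ℤ) (x : Fin q → ℝ) :
    torusHom M (torusProj x) = torusProj (M.map (Int.cast : ℤ → ℝ) *ᵥ x) := by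
  funext i
  rw [torusHom_apply, torusProj, mulVec, dotProduct]
  simp only [torusProj, map_apply]
  rw [← QuotientAddGroup.mk'_apply (AddSubgroup.zmultiples (1 : ℝ)) (∑ j, _), map_sum]
  refine Finset.sum_congr rfl fun j _ => ?_
  rw [← zsmul_eq_mul, map_zsmul]
  rfl

theorem torusProj_add {q : ℕ} (x y : Fin q → ℝ) :
    torusProj (x + y) = torusProj x + torusProj y := rfl

theorem torusHom_inv_cancel {q : ℕ} (M : GL (Fin q) ℤ) (x : Torus q) :
    torusHom (M⁻¹).val (torusHom M.val x) = x := by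
  rw [← torusHom_mul, ← Units.val_mul, inv_mul_cancel, Units.val_one, torusHom_one]

theorem torusHom_cancel_inv {q : ℕ} (M : GL (Fin q) ℤ) (x : Torus q) :
    torusHom M.val (torusHom (M⁻¹).val x) = x := by
  rw [← torusHom_mul, ← Units.val_mul, mul_inv_cancel, Units.val_one, torusHom_one]

/-- The affine homeomorphism `x ↦ M x + b` of the torus. -/
def affineHomeo {q : ℕ} (M : GL (Fin q) ℤ) (b : Torus q) : Torus q ≃ₜ Torus q where
  toFun x := torusHom M.val x + b
  invFun x := torusHom (M⁻¹).val (x - b)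
  left_inv x := by simp only [add_sub_cancel_right, torusHom_inv_cancel]
  right_inv x := by simp only [torusHom_cancel_inv, sub_add_cancel]
  continuous_toFun := (continuous_torusHom _).add continuous_const
  continuous_invFun := (continuous_torusHom _).comp (continuous_id.sub continuous_const)

theorem LatticeAction.mat_add {p q : ℕ} (U : LatticeAction p q) (l l' : Fin p → ℤ) :
    U.mat (l + l') = U.mat l * U.mat l' := by
  simp [LatticeAction.mat, ofAdd_add]

theorem AffineAction.act_add {p q : ℕ} (φ : AffineAction p q) (l l' : Fin p → ℤ) (x : Torus q) :
    φ.act (l + l') x = φ.act l (φ.act l' x) := by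
  simp [AffineAction.act, ofAdd_add]

theorem LatticeAction.exists_affineAction {p q : ℕ} (U : LatticeAction p q)
    {β : (Fin p → ℤ) → Torus q}
    (hβ : ∀ l l', β (l + l') = torusHom (U.mat l) (β l') + β l) :
    ∃ φ : AffineAction p q, ∀ l x, φ.act l x = torusHom (U.mat l) x + β l := by
  refine ⟨MonoidHom.mk' (fun l => ⟨affineHomeo (U l) (β (toAdd l)), U l, β (toAdd l),
    fun x => rfl⟩) fun l l' => ?_, fun l x => rfl⟩
  refine Subtype.ext (Homeomorph.ext fun x => ?_)
  have h : U (l * l') = U l * U l' := map_mul U l l'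
  change torusHom (U (l * l')).val x + β (toAdd l + toAdd l')
    = torusHom (U l).val (torusHom (U l').val x + β (toAdd l')) + β (toAdd l)
  rw [hβ, h, Units.val_mul, torusHom_mul, map_add, add_assoc]
  rfl

theorem LatticeAction.HasNormalForm.mul_mat {p : ℕ} {U : LatticeAction p 3} {P : GL (Fin 3) ℤ}
    {μ ν ω : (Fin p → ℤ) → ℤ} (h : U.HasNormalForm P μ ν ω) (l : Fin p → ℤ) :
    P.val * U.mat l = !![1, 0, 0; μ l, 1, 0; ω l, ν l, 1] * P.val := by
  rw [← h l, mul_assoc, ← Units.val_mul, inv_mul_cancel, Units.val_one, mul_one]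

theorem LatticeAction.HasNormalForm.torusHom_conj {p : ℕ} {U : LatticeAction p 3}
    {P : GL (Fin 3) ℤ} {μ ν ω : (Fin p → ℤ) → ℤ} (h : U.HasNormalForm P μ ν ω)
    (l : Fin p → ℤ) (x : Torus 3) :
    torusHom P.val (torusHom (U.mat l) x) =
      torusHom !![1, 0, 0; μ l, 1, 0; ω l, ν l, 1] (torusHom P.val x) := by
  rw [← torusHom_mul, ← torusHom_mul, h.mul_mat]

theorem torusHom_lower_zero (a b c : ℤ) (x : Torus 3) :
    torusHom !![1, 0, 0; a, 1, 0; b, c, 1] x 0 = x 0 := by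
  simp [torusHom_apply, Fin.sum_univ_three]

theorem torusHom_lower_one (a b c : ℤ) (x : Torus 3) :
    torusHom !![1, 0, 0; a, 1, 0; b, c, 1] x 1 = a • x 0 + x 1 := by
  simp [torusHom_apply, Fin.sum_univ_three]

theorem torusHom_lower_two (a b c : ℤ) (x : Torus 3) :
    torusHom !![1, 0, 0; a, 1, 0; b, c, 1] x 2 = b • x 0 + c • x 1 + x 2 := by
  simp [torusHom_apply, Fin.sum_univ_three]

theorem UnitAddCircle.coe_eq_zero_iff_exists {r : ℝ} :
    (r : UnitAddCircle) = 0 ↔ ∃ n : ℤ, r = n := by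
  rw [AddCircle.coe_eq_zero_iff]
  simp [eq_comm]

/-- Reduces the construction to real functions `a, b, c`. Under each alternative of `hfree`, one
coordinate of `φ(l) x - x` does not depend on `x` and is a nonzero constant of the circle. `hmin` is
needed at one `l` only, since the forward orbits of `φ(l)` are then dense. -/
theorem LatticeAction.HasNormalForm.isLinearPartOfMinimalFree {p : ℕ} {U : LatticeAction p 3}
    {P : GL (Fin 3) ℤ} {μ ν ω : (Fin p → ℤ) → ℤ} (hU : U.HasNormalForm P μ ν ω)
    {a b c : (Fin p → ℤ) → ℝ}
    (ha : ∀ l l', a (l + l') = a l' + a l)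
    (hb : ∀ l l', b (l + l') = μ l * a l' + b l' + b l)
    (hc : ∀ l l', c (l + l') = ω l * a l' + ν l * b l' + c l' + c l)
    (hmin : ∃ l, ∀ x y z n : ℤ, x * a l + y * b l + z * c l = n → x = 0 ∧ y = 0 ∧ z = 0)
    (hfree : ∀ l, l ≠ 0 → (∀ n : ℤ, a l ≠ n) ∨ (μ l = 0 ∧ ∀ n : ℤ, b l ≠ n) ∨
      (ω l = 0 ∧ ν l = 0 ∧ ∀ n : ℤ, c l ≠ n)) :
    U.IsLinearPartOfMinimalFree := by
  set β : (Fin p → ℤ) → Torus 3 := fun l => torusProj ![a l, b l, c l] with hβ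
  have hcoc : ∀ l l', β (l + l') =
      torusHom !![1, 0, 0; μ l, 1, 0; ω l, ν l, 1] (β l') + β l := by
    intro l l'
    rw [hβ]
    simp only
    rw [torusHom_torusProj, ← torusProj_add]
    congr 1
    funext i
    fin_cases i <;> simp [mulVec, dotProduct, Fin.sum_univ_three, ha, hb, hc]
  obtain ⟨φ, hφ⟩ := U.exists_affineAction (β := fun l => torusHom (P⁻¹).val (β l)) (by
    intro l l'
    have inj : Function.Injective (torusHom P.val) :=
      Function.LeftInverse.injective (torusHom_inv_cancel P)
    apply inj
    rw [map_add, hU.torusHom_conj, torusHom_cancel_inv, torusHom_cancel_inv,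
      torusHom_cancel_inv, hcoc])
  have hφP : ∀ l x, torusHom P.val (φ.act l x) =
      torusHom !![1, 0, 0; μ l, 1, 0; ω l, ν l, 1] (torusHom P.val x) + β l := by
    intro l x
    rw [hφ, map_add, hU.torusHom_conj, torusHom_cancel_inv]
  refine ⟨φ, fun l x => ?_, fun x => ?_, fun l hl x hx => ?_⟩
  · rw [hφ l x, hφ l 0, map_zero, zero_add]
  · obtain ⟨l, hl⟩ := hmin
    have hd : DenseRange fun n : ℕ => torusHom P.val (φ.act (n • l) x) := by
      refine denseRange_unipotent_orbit (A := μ l) (B := ν l) (C := ω l) (a := β l) ?_ fun n => ?_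
      · intro k hk h0
        have h1 : ((k 0 * a l + k 1 * b l + k 2 * c l : ℝ) : UnitAddCircle) = 0 := by
          rw [← h0]
          simp only [← zsmul_eq_mul, AddCircle.coe_add, AddCircle.coe_zsmul]
          rfl
        obtain ⟨n, hn⟩ := UnitAddCircle.coe_eq_zero_iff_exists.mp h1
        obtain ⟨e0, e1, e2⟩ := hl _ _ _ _ hn
        exact hk (by funext i; fin_cases i <;> simp [e0, e1, e2])
      · rw [← hφP, succ_nsmul', φ.act_add]
    have hsurj : Function.Surjective (torusHom (P⁻¹).val) :=
      Function.RightInverse.surjective (torusHom_inv_cancel P)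
    have hd2 := hsurj.denseRange.comp hd (continuous_torusHom _)
    refine hd2.mono ?_
    rintro _ ⟨n, rfl⟩
    exact ⟨n • l, by simp only [Function.comp, torusHom_inv_cancel]⟩
  · have h := hφP l x
    rw [hx] at h
    set y := torusHom P.val x
    rcases hfree l hl with h0 | ⟨e, h1⟩ | ⟨e, e', h2⟩
    · have h' := congrFun h 0
      rw [Pi.add_apply, torusHom_lower_zero, left_eq_add] at h'
      obtain ⟨n, hn⟩ := UnitAddCircle.coe_eq_zero_iff_exists.mp h'
      exact h0 n hn
    · have h' := congrFun h 1
      rw [Pi.add_apply, torusHom_lower_one, e, zero_smul, zero_add, left_eq_add] at h'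
      obtain ⟨n, hn⟩ := UnitAddCircle.coe_eq_zero_iff_exists.mp h'
      exact h1 n hn
    · have h' := congrFun h 2
      rw [Pi.add_apply, torusHom_lower_two, e, e', zero_smul, zero_smul, zero_add, zero_add,
        left_eq_add] at h'
      obtain ⟨n, hn⟩ := UnitAddCircle.coe_eq_zero_iff_exists.mp h'
      exact h2 n hn

/-! ### Simultaneous unitriangular form over the integers -/

/-- Replacing `w` by its last nonzero image under powers of `N i` puts it in the kernel of `N i`,
and commutativity keeps it in the kernels already reached. -/
theorem exists_ne_zero_forall_apply_eq_zero {R W ι : Type*} [Ring R] [AddCommGroup W] [Module R W]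
    [Nontrivial W] {N : ι → Module.End R W} (hcomm : ∀ i j, Commute (N i) (N j))
    (hnil : ∀ i, IsNilpotent (N i)) (s : Finset ι) : ∃ w, w ≠ 0 ∧ ∀ i ∈ s, N i w = 0 := by
  classical
  induction s using Finset.induction_on with
  | empty => simpa using exists_ne (0 : W)
  | insert i s hi ih =>
    obtain ⟨w, hw, hs⟩ := ih
    have hex : ∃ k, (N i ^ k) w = 0 := by
      obtain ⟨k, hk⟩ := hnil i
      exact ⟨k, by simp [hk]⟩
    have hpos : Nat.find hex ≠ 0 := fun h => by
      have := Nat.find_spec hex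
      rw [h] at this
      exact hw (by simpa using this)
    obtain ⟨k, hk⟩ := Nat.exists_eq_succ_of_ne_zero hpos
    refine ⟨(N i ^ k) w, Nat.find_min hex (by omega), fun j hj => ?_⟩
    rcases Finset.mem_insert.mp hj with rfl | hj
    · have := Nat.find_spec hex
      rwa [hk, pow_succ', Module.End.mul_apply] at this
    · rw [← Module.End.mul_apply, ((hcomm j i).pow_right k).eq, Module.End.mul_apply, hs j hj,
        map_zero]

/-- The image of `w` is an ideal `gℤ`; dividing by `g` makes the functional primitive, so that its
kernel is a direct summand. -/
theorem exists_surjective_of_ne_zero {V : Type*} [AddCommGroup V] {w : V →ₗ[ℤ] ℤ} (hw : w ≠ 0) :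
    ∃ (g : ℤ) (χ : V →ₗ[ℤ] ℤ), g ≠ 0 ∧ Function.Surjective χ ∧ ∀ v, w v = g * χ v := by
  obtain ⟨g, hg⟩ := (IsPrincipalIdealRing.principal (LinearMap.range w)).principal
  have hg0 : g ≠ 0 := by
    rintro rfl
    refine hw (LinearMap.range_eq_bot.mp ?_)
    rw [hg]; simp
  have hmem : ∀ v, ∃ c : ℤ, w v = g * c := by
    intro v
    have : w v ∈ LinearMap.range w := ⟨v, rfl⟩
    rw [hg] at this
    obtain ⟨c, hc⟩ := Submodule.mem_span_singleton.mp this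
    exact ⟨c, by rw [← hc, smul_eq_mul, mul_comm]⟩
  choose χ hχ using hmem
  refine ⟨g, { toFun := χ, map_add' := fun x y => ?_, map_smul' := fun c x => ?_ }, hg0,
    fun c => ?_, hχ⟩
  · apply mul_left_cancel₀ hg0
    rw [← hχ, map_add, hχ, hχ, mul_add]
  · apply mul_left_cancel₀ hg0
    rw [← hχ, map_smul, hχ]
    simp [mul_left_comm]
  · have : g ∈ LinearMap.range w := by rw [hg]; exact Submodule.mem_span_singleton_self g
    obtain ⟨v, hv⟩ := this
    refine ⟨c • v, ?_⟩
    apply mul_left_cancel₀ hg0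
    change g * χ (c • v) = _
    rw [← hχ, map_smul, hv, smul_eq_mul, mul_comm]

/-- The common kernel vector is sought in the dual, among the transposes of `f i - 1`. A finite
generating set suffices, because invariance passes to products and inverses. -/
theorem exists_surjective_invariant_functional {G V : Type*} [CommGroup G] [Group.FG G]
    [AddCommGroup V] [Module.Free ℤ V] [Nontrivial V] [Module.Finite ℤ V] (f : G →* Module.End ℤ V)
    (hnil : ∀ i, IsNilpotent (f i - 1)) :
    ∃ χ : V →ₗ[ℤ] ℤ, Function.Surjective χ ∧ ∀ i v, χ (f i v) = χ v := by
  obtain ⟨S, hS⟩ := Group.fg_def.mp (inferInstance : Group.FG G)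
  let N : G → Module.End ℤ (V →ₗ[ℤ] ℤ) := fun i => LinearMap.lcomp ℤ ℤ (f i - 1)
  have hN : ∀ i w v, N i w v = w (f i v) - w v := fun i w v => by simp [N]
  have : Nontrivial (V →ₗ[ℤ] ℤ) := inferInstanceAs (Nontrivial (Module.Dual ℤ V))
  obtain ⟨w, hw, h⟩ := exists_ne_zero_forall_apply_eq_zero (N := N)
    (fun i j => by
      refine LinearMap.ext fun w => LinearMap.ext fun v => ?_
      have e : f i (f j v) = f j (f i v) := by
        rw [← Module.End.mul_apply, ← Module.End.mul_apply, ← map_mul, ← map_mul, mul_comm]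
      simp only [Module.End.mul_apply, hN, e]
      ring)
    (fun i => by
      obtain ⟨k, hk⟩ := hnil i
      refine ⟨k, ?_⟩
      have : ∀ k w, (N i ^ k) w = w ∘ₗ ((f i - 1) ^ k) := by
        intro k
        induction k with
        | zero => intro w; rfl
        | succ k ih => intro w; rw [pow_succ, Module.End.mul_apply, ih, pow_succ']; rfl
      refine LinearMap.ext fun w => ?_
      rw [this, hk]; simp)
    S
  have hinv : ∀ i v, w (f i v) = w v := fun i v => by
    have hi : i ∈ Subgroup.closure (S : Set G) := by rw [hS]; trivial
    induction hi using Subgroup.closure_induction generalizing v with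
    | mem i hi => rw [← sub_eq_zero, ← hN, h i hi]; rfl
    | one => rw [map_one, Module.End.one_apply]
    | mul i j _ _ hi hj => rw [map_mul, Module.End.mul_apply, hi, hj]
    | inv i _ hi => rw [← hi, ← Module.End.mul_apply, ← map_mul, mul_inv_cancel, map_one,
        Module.End.one_apply]
  obtain ⟨g, χ, hg, hχ, hw⟩ := exists_surjective_of_ne_zero hw
  refine ⟨χ, hχ, fun i v => mul_left_cancel₀ hg ?_⟩
  rw [← hw, ← hw, hinv]

/-- With `χ y = 1`, the lattice is `ℤy ⊕ ker χ`. Invariance of `χ` gives `f i y - y ∈ ker χ` and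
preserves `ker χ`, where the induction continues; putting `y` first makes the matrices lower
triangular. -/
theorem exists_basis_unitriangular {G : Type*} [CommGroup G] [Group.FG G] (n : ℕ) {V : Type*}
    [AddCommGroup V] [Module.Free ℤ V] [Module.Finite ℤ V] (hn : Module.finrank ℤ V = n)
    (f : G →* Module.End ℤ V) (hnil : ∀ i, IsNilpotent (f i - 1)) :
    ∃ b : Module.Basis (Fin n) ℤ V, ∀ i j k, k ≤ j →
      b.repr (f i (b j)) k = if k = j then 1 else 0 := by
  induction n generalizing V with
  | zero => exact ⟨Module.finBasisOfFinrankEq ℤ V hn, fun i j => j.elim0⟩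
  | succ n ih =>
    have : Nontrivial V := Module.nontrivial_of_finrank_pos (R := ℤ) (by omega)
    obtain ⟨χ, hsurj, hinv⟩ := exists_surjective_invariant_functional f hnil
    obtain ⟨y, hy⟩ := hsurj 1
    let K := LinearMap.ker χ
    have hK : ∀ i, ∀ v ∈ K, f i v ∈ K := fun i v hv => by
      rw [LinearMap.mem_ker] at hv ⊢; rw [hinv, hv]
    have hli : ∀ c : ℤ, ∀ x ∈ K, c • y + x = 0 → c = 0 := by
      intro c x hx h
      have := congrArg χ h
      rw [map_add, map_smul, LinearMap.mem_ker.mp hx, hy] at this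
      simpa using this
    have hsp : ∀ z : V, ∃ c : ℤ, z + c • y ∈ K := fun z =>
      ⟨-χ z, by rw [LinearMap.mem_ker]; simp [hy]⟩
    have hrank : Module.finrank ℤ K = n := by
      have e := Module.finrank_eq_card_basis
        (Module.Basis.mkFinCons y (Module.finBasis ℤ K) hli hsp)
      rw [hn, Fintype.card_fin] at e
      omega
    let g : G →* Module.End ℤ K :=
      { toFun := fun i => (f i).restrict (hK i)
        map_one' := LinearMap.ext fun v => Subtype.ext (by simp)
        map_mul' := fun i j => LinearMap.ext fun v => Subtype.ext (by simp) }
    obtain ⟨b, hb⟩ := ih hrank g fun i => by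
      obtain ⟨k, hk⟩ := hnil i
      refine ⟨k, LinearMap.ext fun v => Subtype.ext ?_⟩
      have : ∀ (k : ℕ) (v : K), (((g i - 1) ^ k : Module.End ℤ K) v : V) =
          ((f i - 1) ^ k : Module.End ℤ V) (v : V) := by
        intro k
        induction k with
        | zero => intro v; rfl
        | succ k ih => intro v; rw [pow_succ, Module.End.mul_apply, ih, pow_succ]; rfl
      rw [this, hk]; rfl
    let B := Module.Basis.mkFinCons y b hli hsp
    have hB : (B : Fin (n + 1) → V) = Fin.cons y ((↑) ∘ b) :=
      Module.Basis.coe_mkFinCons y b hli hsp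
    have hB0 : B 0 = y := by rw [hB]; rfl
    have hBs : ∀ j : Fin n, B j.succ = b j := fun j => by rw [hB]; rfl
    have hrepr : ∀ x : K, B.repr (x : V) = Finsupp.mapDomain Fin.succ (b.repr x) := by
      intro x
      apply B.repr.symm.injective
      rw [LinearEquiv.symm_apply_apply, Module.Basis.repr_symm_apply,
        Finsupp.linearCombination_mapDomain]
      have : (B : Fin (n + 1) → V) ∘ Fin.succ = K.subtype ∘ b := by
        funext j; exact hBs j
      rw [this, ← Finsupp.apply_linearCombination, b.linearCombination_repr]
      rfl
    have hK0 : ∀ x : K, B.repr (x : V) 0 = 0 := fun x => by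
      rw [hrepr, Finsupp.mapDomain_of_notMem_range]
      rintro ⟨j, hj⟩
      exact Fin.succ_ne_zero j hj
    have hKs : ∀ (x : K) (j : Fin n), B.repr (x : V) j.succ = b.repr x j := fun x j => by
      rw [hrepr, Finsupp.mapDomain_apply (Fin.succ_injective n)]
    refine ⟨B, fun i j k hjk => ?_⟩
    induction j using Fin.cases with
    | zero =>
      obtain rfl : k = 0 := Fin.le_zero_iff.mp hjk
      have hd : f i y - y ∈ K := by rw [LinearMap.mem_ker, map_sub, hinv, sub_self]
      have e : f i (B 0) = B 0 + ((⟨_, hd⟩ : K) : V) := by rw [hB0]; simp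
      rw [e, map_add, Finsupp.add_apply, hK0, B.repr_self]
      simp
    | succ j =>
      have e : f i (B j.succ) = ((g i (b j) : K) : V) := by rw [hBs]; rfl
      rw [e]
      induction k using Fin.cases with
      | zero => rw [hK0, if_neg (Fin.succ_ne_zero j).symm]
      | succ k =>
        rw [hKs, hb i j k (Fin.succ_le_succ_iff.mp hjk)]
        simp

theorem LatticeAction.IsUnipotent.exists_hasNormalForm {p : ℕ} {U : LatticeAction p 3}
    (hU : U.IsUnipotent) :
    ∃ (P : GL (Fin 3) ℤ) (μ ν ω : (Fin p → ℤ) → ℤ), U.HasNormalForm P μ ν ω := by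
  have : Group.FG (Multiplicative (Fin p → ℤ)) := inferInstance
  let F : Multiplicative (Fin p → ℤ) →* Module.End ℤ (Fin 3 → ℤ) :=
    ((Matrix.toLinAlgEquiv' : Matrix (Fin 3) (Fin 3) ℤ ≃ₐ[ℤ] _) :
      Matrix (Fin 3) (Fin 3) ℤ →* _).comp ((Units.coeHom _).comp U)
  have hF : ∀ l, F (ofAdd l) = Matrix.toLin' (U.mat l) := fun l => rfl
  obtain ⟨b, hb⟩ := exists_basis_unitriangular 3 (by simp) F fun i => by
    have := (hU (toAdd i)).map (Matrix.toLinAlgEquiv' : Matrix (Fin 3) (Fin 3) ℤ ≃ₐ[ℤ] _)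
    rw [map_sub, map_one] at this
    exact this
  let e := Pi.basisFun ℤ (Fin 3)
  let P : GL (Fin 3) ℤ := ⟨b.toMatrix e, e.toMatrix b, b.toMatrix_mul_toMatrix_flip e,
    e.toMatrix_mul_toMatrix_flip b⟩
  have hP : ∀ l, P.val * U.mat l * (P⁻¹).val = LinearMap.toMatrix b b (F (ofAdd l)) := by
    intro l
    rw [← basis_toMatrix_mul_linearMap_toMatrix_mul_basis_toMatrix b e b e, hF]
    change _ = b.toMatrix e * LinearMap.toMatrix' (Matrix.toLin' (U.mat l)) * e.toMatrix b
    rw [LinearMap.toMatrix'_toLin']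
    rfl
  refine ⟨P, fun l => LinearMap.toMatrix b b (F (ofAdd l)) 1 0,
    fun l => LinearMap.toMatrix b b (F (ofAdd l)) 2 1,
    fun l => LinearMap.toMatrix b b (F (ofAdd l)) 2 0, fun l => ?_⟩
  rw [hP]
  ext i j
  by_cases hij : i ≤ j
  · rw [LinearMap.toMatrix_apply, hb _ j i hij]
    fin_cases i <;> fin_cases j <;> first | rfl | exact absurd hij (by decide)
  · fin_cases i <;> fin_cases j <;> first | rfl | exact absurd (by decide) hij

/-! ### Relations among the coefficients; the exceptional case as a determinant condition -/

theorem LatticeAction.HasNormalForm.lower_add {p : ℕ} {U : LatticeAction p 3}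
    {P : GL (Fin 3) ℤ} {μ ν ω : (Fin p → ℤ) → ℤ} (h : U.HasNormalForm P μ ν ω)
    (l l' : Fin p → ℤ) :
    (!![1, 0, 0; μ (l + l'), 1, 0; ω (l + l'), ν (l + l'), 1] : Matrix (Fin 3) (Fin 3) ℤ) =
      !![1, 0, 0; μ l, 1, 0; ω l, ν l, 1] * !![1, 0, 0; μ l', 1, 0; ω l', ν l', 1] := by
  rw [← h (l + l'), U.mat_add, ← mul_assoc, h.mul_mat, mul_assoc _ P.val, h.mul_mat, mul_assoc,
    mul_assoc, ← Units.val_mul, mul_inv_cancel, Units.val_one, mul_one]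

theorem LatticeAction.HasNormalForm.coeff_add {p : ℕ} {U : LatticeAction p 3}
    {P : GL (Fin 3) ℤ} {μ ν ω : (Fin p → ℤ) → ℤ} (h : U.HasNormalForm P μ ν ω)
    (l l' : Fin p → ℤ) :
    μ (l + l') = μ l + μ l' ∧ ν (l + l') = ν l + ν l' ∧
      ω (l + l') = ω l + ν l * μ l' + ω l' := by
  have e := h.lower_add l l'
  have e1 := congrFun (congrFun e 1) 0
  have e2 := congrFun (congrFun e 2) 1
  have e3 := congrFun (congrFun e 2) 0
  simp [Matrix.mul_apply, Fin.sum_univ_three] at e1 e2 e3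
  exact ⟨e1, e2, e3⟩

/-- The product term in the law for `ω` must be symmetric because `ℤ^p` is commutative. Hence `μ`
and `ν` are always proportional. -/
theorem LatticeAction.HasNormalForm.coeff_mul_comm {p : ℕ} {U : LatticeAction p 3}
    {P : GL (Fin 3) ℤ} {μ ν ω : (Fin p → ℤ) → ℤ} (h : U.HasNormalForm P μ ν ω)
    (l l' : Fin p → ℤ) : ν l * μ l' = ν l' * μ l := by
  have h1 := (h.coeff_add l l').2.2
  have h2 := (h.coeff_add l' l).2.2
  rw [add_comm l' l] at h2
  linarith

theorem IsExceptional.exists_det_ne_zero {p : ℕ} {μ ν ω : (Fin p → ℤ) → ℤ}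
    (h : IsExceptional μ ν ω) : ∃ l l', μ l * ω l' - μ l' * ω l ≠ 0 := by
  by_contra! hdet
  have hind := LinearIndependent.pair_iff.mp h.2
  have hz : ∀ l, μ l = 0 ∧ ω l = 0 := by
    intro l
    have := hind (ω l) (-μ l) (by
      funext l'
      have := hdet l l'
      simp only [Pi.add_apply, Pi.smul_apply, smul_eq_mul, Pi.zero_apply]
      exact_mod_cast (by linarith : ω l * μ l' + -μ l * ω l' = 0))
    simp at this
    exact ⟨this.2, this.1⟩
  have := hind 1 0 (by funext l; simp [(hz l).1])
  exact one_ne_zero this.1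

theorem isExceptional_of_det_ne_zero {p : ℕ} {μ ν ω : (Fin p → ℤ) → ℤ} (hν : ν = 0)
    {l l' : Fin p → ℤ} (h : μ l * ω l' - μ l' * ω l ≠ 0) : IsExceptional μ ν ω := by
  refine ⟨hν, LinearIndependent.pair_iff.mpr fun s t hst => ?_⟩
  have e := congrFun hst l
  have e' := congrFun hst l'
  simp only [Pi.add_apply, Pi.smul_apply, smul_eq_mul, Pi.zero_apply] at e e'
  have h' : ((μ l : ℚ) * ω l' - μ l' * ω l) ≠ 0 := by exact_mod_cast h
  constructor
  · refine (mul_eq_zero.mp (?_ : s * ((μ l : ℚ) * ω l' - μ l' * ω l) = 0)).resolve_right h'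
    linear_combination (ω l' : ℚ) * e - (ω l : ℚ) * e'
  · refine (mul_eq_zero.mp (?_ : t * ((μ l : ℚ) * ω l' - μ l' * ω l) = 0)).resolve_right h'
    linear_combination (μ l : ℚ) * e' - (μ l' : ℚ) * e

/-! ### The obstruction in the exceptional case -/

/-- The determinant kills `a l₀` and `a l₁`; since `μ l₀ • a l = μ l • a l₀`, a further factor `μ
l₀` (or `μ l₁`, whichever is nonzero) kills every `a l`. The group may have torsion, so `N` cannot
be cancelled here, but it is the same for all `l`. -/
theorem exists_zsmul_eq_zero_of_symm {L G : Type*} [AddCommGroup G] {μ ω : L → ℤ}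
    {l₀ l₁ : L} (hdet : μ l₀ * ω l₁ - μ l₁ * ω l₀ ≠ 0) :
    ∃ N : ℤ, N ≠ 0 ∧ ∀ a : L → G, (∀ l l', μ l • a l' = μ l' • a l) →
      (∀ l l', ω l • a l' = ω l' • a l) → ∀ l, N • a l = 0 := by
  have key : ∀ a : L → G, (∀ l l', μ l • a l' = μ l' • a l) →
      (∀ l l', ω l • a l' = ω l' • a l) → ∀ l l', (μ l * ω l' - μ l' * ω l) • a l = 0 ∧
      (μ l * ω l' - μ l' * ω l) • a l' = 0 := by
    intro a hμ hω l l'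
    constructor
    · rw [sub_smul, mul_smul, mul_comm, mul_smul, ← hω l l', ← hμ l l', smul_comm, sub_self]
    · rw [sub_smul, mul_smul, mul_smul, smul_comm (μ l), hμ l l', smul_comm (ω l'), ← hω l l',
        sub_self]
  have hne : μ l₀ ≠ 0 ∨ μ l₁ ≠ 0 := by
    by_contra! h
    simp [h] at hdet
  rcases hne with h | h
  · refine ⟨(μ l₀ * ω l₁ - μ l₁ * ω l₀) * μ l₀, mul_ne_zero hdet h, fun a hμ hω l => ?_⟩
    rw [mul_smul, hμ, smul_comm, (key a hμ hω _ _).1, smul_zero]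
  · refine ⟨(μ l₀ * ω l₁ - μ l₁ * ω l₀) * μ l₁, mul_ne_zero hdet h, fun a hμ hω l => ?_⟩
    rw [mul_smul, hμ, smul_comm, (key a hμ hω _ _).2, smul_zero]

theorem symm_of_cocycle {L G : Type*} [AddCommGroup L] [AddCommGroup G] {m : L → ℤ} {a b : L → G}
    (h : ∀ l l', b (l + l') = m l • a l' + b l' + b l) (l l' : L) : m l • a l' = m l' • a l := by
  have h1 := h l l'
  rw [add_comm l l', h l' l, add_assoc, add_assoc, add_comm (b l)] at h1
  exact (add_right_cancel h1).symm

theorem LatticeAction.HasNormalForm.exists_zsmul_eq_zero {p : ℕ} {U : LatticeAction p 3}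
    {P : GL (Fin 3) ℤ} {μ ν ω : (Fin p → ℤ) → ℤ} (hU : U.HasNormalForm P μ ν ω)
    (he : IsExceptional μ ν ω) {φ : AffineAction p 3} (hφ : φ.HasLinearPart U) :
    ∃ N : ℤ, N ≠ 0 ∧ ∀ l, N • torusHom P.val (φ.act l 0) 0 = 0 := by
  obtain ⟨l₀, l₁, hdet⟩ := he.exists_det_ne_zero
  obtain ⟨N, hN, h⟩ := exists_zsmul_eq_zero_of_symm (G := UnitAddCircle) hdet
  have hν : ∀ l, ν l = 0 := fun l => by rw [he.1]; rfl
  have hcoc : ∀ l l', torusHom P.val (φ.act (l + l') 0) =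
      torusHom !![1, 0, 0; μ l, 1, 0; ω l, ν l, 1] (torusHom P.val (φ.act l' 0)) +
        torusHom P.val (φ.act l 0) := by
    intro l l'
    rw [φ.act_add, hφ l (φ.act l' 0), map_add, hU.torusHom_conj]
  refine ⟨N, hN, h (fun l => torusHom P.val (φ.act l 0) 0) ?_ ?_⟩
  · refine symm_of_cocycle (b := fun l => torusHom P.val (φ.act l 0) 1) fun l l' => ?_
    simp only [hcoc, Pi.add_apply, torusHom_lower_one]
  · refine symm_of_cocycle (b := fun l => torusHom P.val (φ.act l 0) 2) fun l l' => ?_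
    simp only [hcoc, Pi.add_apply, torusHom_lower_two, hν, zero_smul, add_zero]

theorem LatticeAction.HasNormalForm.lift_coord_eq_zero {p : ℕ} {U : LatticeAction p 3}
    {P : GL (Fin 3) ℤ} {μ ν ω : (Fin p → ℤ) → ℤ} (hU : U.HasNormalForm P μ ν ω)
    (he : IsExceptional μ ν ω) {α : (Fin p → ℤ) → Fin 3 → ℝ}
    (hα : ∀ l l', α (l + l') = (U.mat l).map (Int.cast : ℤ → ℝ) *ᵥ α l' + α l)
    (l : Fin p → ℤ) : (P.val.map (Int.cast : ℤ → ℝ) *ᵥ α l) 0 = 0 := by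
  obtain ⟨l₀, l₁, hdet⟩ := he.exists_det_ne_zero
  obtain ⟨N, hN, h⟩ := exists_zsmul_eq_zero_of_symm (G := ℝ) hdet
  have hν : ∀ l, ν l = 0 := fun l => by rw [he.1]; rfl
  have hmul : ∀ M M' : Matrix (Fin 3) (Fin 3) ℤ, (M * M').map (Int.cast : ℤ → ℝ) =
      M.map (Int.cast : ℤ → ℝ) * M'.map (Int.cast : ℤ → ℝ) := fun M M' =>
    Matrix.map_mul (f := Int.castRingHom ℝ)
  have hcoc : ∀ l l', P.val.map (Int.cast : ℤ → ℝ) *ᵥ α (l + l') =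
      (!![1, 0, 0; μ l, 1, 0; ω l, ν l, 1] : Matrix (Fin 3) (Fin 3) ℤ).map (Int.cast : ℤ → ℝ) *ᵥ
        (P.val.map (Int.cast : ℤ → ℝ) *ᵥ α l') + P.val.map (Int.cast : ℤ → ℝ) *ᵥ α l := by
    intro l l'
    rw [hα, mulVec_add, mulVec_mulVec, mulVec_mulVec, ← hmul, ← hmul, hU.mul_mat]
  have hlow : ∀ l (x : Fin 3 → ℝ), ((!![1, 0, 0; μ l, 1, 0; ω l, ν l, 1] :
      Matrix (Fin 3) (Fin 3) ℤ).map (Int.cast : ℤ → ℝ) *ᵥ x) 1 = μ l • x 0 + x 1 ∧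
      ((!![1, 0, 0; μ l, 1, 0; ω l, ν l, 1] :
      Matrix (Fin 3) (Fin 3) ℤ).map (Int.cast : ℤ → ℝ) *ᵥ x) 2 = ω l • x 0 + x 2 := by
    intro l x
    simp [mulVec, dotProduct, Fin.sum_univ_three, hν]
  have := h (fun l => (P.val.map (Int.cast : ℤ → ℝ) *ᵥ α l) 0)
    (symm_of_cocycle (b := fun l => (P.val.map (Int.cast : ℤ → ℝ) *ᵥ α l) 1) fun l l' => by
      simp only [hcoc, Pi.add_apply, (hlow l _).1])
    (symm_of_cocycle (b := fun l => (P.val.map (Int.cast : ℤ → ℝ) *ᵥ α l) 2) fun l l' => by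
      simp only [hcoc, Pi.add_apply, (hlow l _).2]) l
  exact (smul_eq_zero.mp this).resolve_left hN

theorem LatticeAction.HasNormalForm.not_irrationality {p : ℕ} {U : LatticeAction p 3}
    {P : GL (Fin 3) ℤ} {μ ν ω : (Fin p → ℤ) → ℤ} (hU : U.HasNormalForm P μ ν ω)
    (he : IsExceptional μ ν ω) {φ : AffineAction p 3} (hφ : φ.HasLinearPart U) :
    ¬ φ.Irrationality U := by
  intro hirr
  obtain ⟨N, hN, h⟩ := hU.exists_zsmul_eq_zero he hφ
  -- The first row of the normal form is `(1, 0, 0)`, so `N` times the first coordinate functional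
  -- is dual-invariant; its pairing with a lift `a` is `N` times the first coordinate of `P a`, an
  -- integer.
  have hk : ∀ l, (U.mat l)ᵀ *ᵥ (P.valᵀ *ᵥ ![N, 0, 0]) = P.valᵀ *ᵥ ![N, 0, 0] := by
    intro l
    rw [mulVec_mulVec, ← transpose_mul, hU.mul_mat, transpose_mul, ← mulVec_mulVec]
    congr 1
    funext i
    fin_cases i <;> simp [mulVec, dotProduct, Fin.sum_univ_three]
  obtain ⟨l, hl⟩ := hirr _ hk (fun h0 => by
    have := congrArg (fun v => (P⁻¹).valᵀ *ᵥ v) h0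
    simp only [mulVec_zero] at this
    rw [mulVec_mulVec, ← transpose_mul, ← Units.val_mul, mul_inv_cancel, Units.val_one,
      transpose_one, one_mulVec] at this
    exact hN (congrFun this 0))
  obtain ⟨a, ha⟩ : ∃ a : Fin 3 → ℝ, torusProj a = φ.act l 0 :=
    ⟨fun i => Quotient.out (φ.act l 0 i), funext fun i => Quotient.out_eq _⟩
  have hz := h l
  rw [← ha, torusHom_torusProj, torusProj, ← AddCircle.coe_zsmul] at hz
  obtain ⟨n, hn⟩ := UnitAddCircle.coe_eq_zero_iff_exists.mp hz
  refine hl a ha n ?_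
  rw [← hn]
  simp [mulVec, dotProduct, Fin.sum_univ_three]
  ring

theorem LatticeAction.HasNormalForm.not_isMinimal {p : ℕ} {U : LatticeAction p 3}
    {P : GL (Fin 3) ℤ} {μ ν ω : (Fin p → ℤ) → ℤ} (hU : U.HasNormalForm P μ ν ω)
    (he : IsExceptional μ ν ω) {φ : AffineAction p 3} (hφ : φ.HasLinearPart U) :
    ¬ φ.IsMinimal := by
  intro hmin
  obtain ⟨N, hN, h⟩ := hU.exists_zsmul_eq_zero he hφ
  have hclosed : IsClosed {x : Torus 3 | N • torusHom P.val x 0 = 0} :=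
    isClosed_eq (((continuous_apply 0).comp (continuous_torusHom P.val)).zsmul N)
      continuous_const
  have hall : ∀ x : Torus 3, N • torusHom P.val x 0 = 0 := by
    have := (hmin 0).closure_eq.symm.subset.trans
      (closure_minimal (Set.range_subset_iff.mpr h) hclosed)
    exact fun x => this trivial
  -- A point with first coordinate `1 / (2N)` is sent to `1 / 2`, so the closed set containing the
  -- orbit is proper.
  have h1 := hall (torusHom (P⁻¹).val (torusProj ![1 / 2 / (N : ℝ), 0, 0]))
  rw [torusHom_cancel_inv, torusProj, ← AddCircle.coe_zsmul] at h1
  obtain ⟨n, hn⟩ := UnitAddCircle.coe_eq_zero_iff_exists.mp h1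
  have hN' : (N : ℝ) ≠ 0 := by exact_mod_cast hN
  simp only [cons_val_zero, zsmul_eq_mul] at hn
  field_simp at hn
  have : (1 : ℤ) = 2 * n := by exact_mod_cast hn
  omega

/-! ### Construction of minimal free actions in the remaining cases -/

theorem exists_common_factor {p : ℕ} (hp : 1 ≤ p) (f g : (Fin p → ℤ) →ₗ[ℤ] ℤ)
    (h : ∀ l l', f l * g l' = f l' * g l) :
    ∃ (m : (Fin p → ℤ) →ₗ[ℤ] ℤ) (l₀ : Fin p → ℤ), m l₀ = 1 ∧
      ∀ l, f l = f l₀ * m l ∧ g l = g l₀ * m l := by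
  have main : ∀ f g : (Fin p → ℤ) →ₗ[ℤ] ℤ, (∀ l l', f l * g l' = f l' * g l) → f ≠ 0 →
      ∃ (m : (Fin p → ℤ) →ₗ[ℤ] ℤ) (l₀ : Fin p → ℤ), m l₀ = 1 ∧
        ∀ l, f l = f l₀ * m l ∧ g l = g l₀ * m l := by
    intro f g h hf
    obtain ⟨c, m, hc, hm, hfm⟩ := exists_surjective_of_ne_zero hf
    obtain ⟨l₀, hl₀⟩ := hm 1
    refine ⟨m, l₀, hl₀, fun l => ⟨by rw [hfm l, hfm l₀, hl₀, mul_one], ?_⟩⟩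
    have := h l₀ l
    rw [hfm, hfm, hl₀] at this
    exact mul_left_cancel₀ hc (by linarith)
  by_cases hf : f = 0
  · by_cases hg : g = 0
    -- When both functionals vanish any primitive `m` will do; the existence of a coordinate uses `1
    -- ≤ p`.
    · exact ⟨LinearMap.proj ⟨0, hp⟩, fun _ => 1, rfl, fun l => by simp [hf, hg]⟩
    · obtain ⟨m, l₀, h1, h2⟩ := main g f (fun l l' => by linarith [h l l']) hg
      exact ⟨m, l₀, h1, fun l => (h2 l).symm⟩
  · exact main f g h hf

/-- Distinct powers of a transcendental number, here a Liouville number, are independent over `ℚ`.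
-/
theorem exists_rationally_independent_reals (p : ℕ) :
    ∃ (s t : ℝ) (τ : Fin p → ℝ), ∀ (n x y : ℚ) (z : Fin p → ℚ),
      (n : ℝ) + x * s + y * t + ∑ i, z i * τ i = 0 → n = 0 ∧ x = 0 ∧ y = 0 ∧ z = 0 := by
  have hθ := transcendental_liouvilleNumber (le_refl 2)
  set θ : ℝ := liouvilleNumber (2 : ℕ)
  refine ⟨θ, θ ^ 2, fun i => θ ^ (i.val + 3), fun n x y z h => ?_⟩
  have hθ' : Transcendental ℚ θ := fun h' => hθ ((IsFractionRing.isAlgebraic_iff ℤ ℚ ℝ).mpr h')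
  open Polynomial in
  have hq : (C n + C x * X + C y * X ^ 2 + ∑ i : Fin p, C (z i) * X ^ (i.val + 3) : ℚ[X]) = 0 := by
    refine (transcendental_iff.mp hθ') _ ?_
    rw [← h]
    simp
  have coeff := fun k => congrArg (fun q => Polynomial.coeff q k) hq
  simp only [Polynomial.coeff_add, Polynomial.finsetSum_coeff, Polynomial.coeff_C_mul,
    Polynomial.coeff_X_pow, Polynomial.coeff_C, Polynomial.coeff_X, Polynomial.coeff_zero] at coeff
  refine ⟨by simpa using coeff 0, by simpa using coeff 1, by simpa using coeff 2, ?_⟩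
  funext i
  have := coeff (i.val + 3)
  simpa [Fin.val_inj, eq_comm (a := i)] using this

theorem LatticeAction.HasNormalForm.isLinearPartOfMinimalFree_of_eq_zero {p : ℕ}
    {U : LatticeAction p 3} {P : GL (Fin 3) ℤ} {μ ν ω : (Fin p → ℤ) → ℤ}
    (hU : U.HasNormalForm P μ ν ω) {m : (Fin p → ℤ) →ₗ[ℤ] ℤ} {l₀ : Fin p → ℤ} (hm : m l₀ = 1)
    {c d : ℤ} (hμ : ∀ l, μ l = c * m l) (hν : ∀ l, ν l = 0) (hω : ∀ l, ω l = d * m l) :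
    U.IsLinearPartOfMinimalFree := by
  obtain ⟨s, t, τ, ind⟩ := exists_rationally_independent_reals p
  -- The quadratic terms solve the cocycle equations for `a = s * m`; the rest are free
  -- homomorphisms. `t` makes `c` independent at `l₀`, while the `τ i` serve both independence of
  -- `b` at `l₀` and freeness on `ker m`, where `μ` vanishes.
  refine hU.isLinearPartOfMinimalFree
    (a := fun l => s * m l) (b := fun l => c * s * (m l) ^ 2 / 2 + ∑ i, l i * τ i)
    (c := fun l => d * s * (m l) ^ 2 / 2 + t * m l) (fun l l' => ?_) (fun l l' => ?_)
    (fun l l' => ?_) ⟨l₀, fun x y z n h => ?_⟩ fun l hl => ?_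
  · simp only [map_add]; push_cast; ring
  · simp only [map_add, hμ, Pi.add_apply]; push_cast
    simp only [add_mul, Finset.sum_add_distrib]; ring
  · simp only [map_add, hω, hν]; push_cast; ring
  · have hl₀ : l₀ ≠ 0 := by rintro rfl; simp at hm
    obtain ⟨i, hi⟩ := Function.ne_iff.mp hl₀
    obtain ⟨-, h1, h2, h3⟩ := ind (-n) (x + y * c / 2 + z * d / 2) z (fun i => y * l₀ i) (by
      push_cast
      simp only [mul_assoc (y : ℝ), ← Finset.mul_sum]
      rw [hm] at h
      push_cast at h
      linear_combination h)
    have hz : z = 0 := by exact_mod_cast h2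
    have hy : y = 0 := by
      have h4 : (y * l₀ i : ℚ) = 0 := congrFun h3 i
      have h5 : y * l₀ i = 0 := by exact_mod_cast h4
      exact (mul_eq_zero.mp h5).resolve_right hi
    subst hz hy
    exact ⟨by simpa using h1, rfl, rfl⟩
  · by_cases hml : m l = 0
    · refine Or.inr (Or.inl ⟨by rw [hμ, hml, mul_zero], fun n hn => hl ?_⟩)
      obtain ⟨-, -, -, h⟩ := ind (-n) 0 0 (fun i => l i) (by
        rw [hml] at hn
        push_cast at hn ⊢
        linear_combination hn)
      funext i
      have := congrFun h i
      simpa using this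
    · refine Or.inl fun n hn => hml ?_
      obtain ⟨-, h, -, -⟩ := ind (-n) (m l) 0 0 (by
        simp only [Pi.zero_apply, Rat.cast_zero, zero_mul, Finset.sum_const_zero]
        push_cast
        linear_combination hn)
      exact_mod_cast h

theorem LatticeAction.HasNormalForm.isLinearPartOfMinimalFree_of_ne_zero {p : ℕ}
    {U : LatticeAction p 3} {P : GL (Fin 3) ℤ} {μ ν ω : (Fin p → ℤ) → ℤ}
    (hU : U.HasNormalForm P μ ν ω) {m : (Fin p → ℤ) →ₗ[ℤ] ℤ} {l₀ : Fin p → ℤ} (hm : m l₀ = 1)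
    {A B : ℤ} (hB : B ≠ 0) (hμ : ∀ l, μ l = A * m l) (hν : ∀ l, ν l = B * m l) :
    U.IsLinearPartOfMinimalFree := by
  obtain ⟨s, t, τ, ind⟩ := exists_rationally_independent_reals p
  have hBr : (B : ℝ) ≠ 0 := by exact_mod_cast hB
  have hBq : (B : ℚ) ≠ 0 := by exact_mod_cast hB
  have hω : ∀ l l', ω (l + l') = ω l + B * m l * (A * m l') + ω l' := fun l l' => by
    rw [(hU.coeff_add l l').2.2, hμ, hν]
  -- Subtracting the quadratic part turns `ω` into a homomorphism; the denominator `2` makes it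
  -- rational-valued.
  let W : (Fin p → ℤ) → ℚ := fun l => ω l - A * B * (m l) ^ 2 / 2
  have hωW : ∀ l, (ω l : ℝ) = W l + A * B * (m l) ^ 2 / 2 := fun l => by
    simp only [W]; push_cast; ring
  have hW : ∀ l l', W (l + l') = W l + W l' := fun l l' => by
    simp only [W, hω, map_add]; push_cast; ring
  -- The equation for `c` needs `ω l * a l' + ν l * b l'` symmetric in `l, l'`. The part `s * W l *
  -- m l'` is not, and the term `s / B * W` in `b` supplies its mirror image; this is where `B ≠ 0`
  -- enters. On `ker m` that same term equals `s * ω l / B`, which gives freeness when `ω l ≠ 0`;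
  -- the `τ i` cover `ω l = 0`.
  refine hU.isLinearPartOfMinimalFree
    (a := fun l => s * m l) (b := fun l => A * s * (m l) ^ 2 / 2 + s / B * W l + t * m l)
    (c := fun l => A * B * s * (m l) ^ 3 / 6 + s * W l * m l + B * t * (m l) ^ 2 / 2
      + ∑ i, l i * τ i) (fun l l' => ?_) (fun l l' => ?_)
    (fun l l' => ?_) ⟨l₀, fun x y z n h => ?_⟩ fun l hl => ?_
  · simp only [map_add]; push_cast; ring
  · simp only [map_add, hμ, hW]; push_cast; ring
  · simp only [map_add, hωW, hν, hW, Pi.add_apply]; push_cast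
    simp only [add_mul, Finset.sum_add_distrib]; field_simp; ring
  · have hl₀ : l₀ ≠ 0 := by rintro rfl; simp at hm
    obtain ⟨i, hi⟩ := Function.ne_iff.mp hl₀
    obtain ⟨-, h1, h2, h3⟩ := ind (-n)
      (x + y * (A / 2 + W l₀ / B) + z * (A * B / 6 + W l₀)) (y + z * B / 2)
      (fun i => z * l₀ i) (by
        push_cast
        simp only [mul_assoc (z : ℝ), ← Finset.mul_sum]
        rw [hm] at h
        push_cast at h
        linear_combination h)
    have hz : z = 0 := by
      have h4 : (z * l₀ i : ℚ) = 0 := congrFun h3 i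
      have h5 : z * l₀ i = 0 := by exact_mod_cast h4
      exact (mul_eq_zero.mp h5).resolve_right hi
    subst hz
    have hy : y = 0 := by simpa using h2
    subst hy
    exact ⟨by simpa using h1, rfl, rfl⟩
  · by_cases hml : m l = 0
    · refine Or.inr ?_
      by_cases hωl : ω l = 0
      · refine Or.inr ⟨hωl, by rw [hν, hml, mul_zero], fun n hn => hl ?_⟩
        obtain ⟨-, -, -, h⟩ := ind (-n) 0 0 (fun i => l i) (by
          rw [hml] at hn
          push_cast at hn ⊢
          linear_combination hn)
        funext i
        have := congrFun h i
        simpa using this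
      · refine Or.inl ⟨by rw [hμ, hml, mul_zero], fun n hn => hωl ?_⟩
        obtain ⟨-, h, -, -⟩ := ind (-n) (ω l / B) 0 0 (by
          have hWl : W l = ω l := by simp [W, hml]
          rw [hml, hWl] at hn
          simp only [Pi.zero_apply, Rat.cast_zero, zero_mul, Finset.sum_const_zero]
          push_cast at hn ⊢
          linear_combination hn)
        exact_mod_cast (div_eq_zero_iff.mp h).resolve_right hBq
    · refine Or.inl fun n hn => hml ?_
      obtain ⟨-, h, -, -⟩ := ind (-n) (m l) 0 0 (by
        simp only [Pi.zero_apply, Rat.cast_zero, zero_mul, Finset.sum_const_zero]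
        push_cast
        linear_combination hn)
      exact_mod_cast h

theorem LatticeAction.HasNormalForm.isLinearPartOfMinimalFree_of_not_isExceptional {p : ℕ}
    (hp : 1 ≤ p) {U : LatticeAction p 3} {P : GL (Fin 3) ℤ} {μ ν ω : (Fin p → ℤ) → ℤ}
    (hU : U.HasNormalForm P μ ν ω) (he : ¬ IsExceptional μ ν ω) :
    U.IsLinearPartOfMinimalFree := by
  let μ' := (AddMonoidHom.mk' μ fun l l' => (hU.coeff_add l l').1).toIntLinearMap
  by_cases hν : ν = 0
  · have hν' : ∀ l, ν l = 0 := fun l => by rw [hν]; rfl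
    let ω' := (AddMonoidHom.mk' ω fun l l' => by
      rw [(hU.coeff_add l l').2.2, hν', zero_mul, add_zero]).toIntLinearMap
    obtain ⟨m, l₀, hm, h⟩ := exists_common_factor hp μ' ω' fun l l' => by
      by_contra hne
      exact he (isExceptional_of_det_ne_zero hν (sub_ne_zero.mpr hne))
    exact hU.isLinearPartOfMinimalFree_of_eq_zero hm (fun l => (h l).1) hν' (fun l => (h l).2)
  · let ν' := (AddMonoidHom.mk' ν fun l l' => (hU.coeff_add l l').2.1).toIntLinearMap
    obtain ⟨m, l₀, hm, h⟩ := exists_common_factor hp ν' μ' fun l l' => hU.coeff_mul_comm l l'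
    refine hU.isLinearPartOfMinimalFree_of_ne_zero hm (B := ν l₀) (fun h0 => hν ?_)
      (fun l => (h l).2) (fun l => (h l).1)
    funext l
    have : ν l = ν l₀ * m l := (h l).1
    rw [this, h0, zero_mul]; rfl

theorem mainTheorem6 (p : ℕ) (hp : 1 ≤ p) (U : LatticeAction p 3) (hU : U.IsUnipotent) :
    (∃ (P : GL (Fin 3) ℤ) (μ ν ω : (Fin p → ℤ) → ℤ), U.HasNormalForm P μ ν ω) ∧
    ∀ (P : GL (Fin 3) ℤ) (μ ν ω : (Fin p → ℤ) → ℤ), U.HasNormalForm P μ ν ω →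
      (U.IsLinearPartOfMinimalFree ↔ ¬ IsExceptional μ ν ω) ∧
      (IsExceptional μ ν ω → ∀ φ : AffineAction p 3, φ.HasLinearPart U →
        (∀ α : (Fin p → ℤ) → Fin 3 → ℝ, φ.LiftsTo U α →
          ∀ l, (P.val.map (Int.cast : ℤ → ℝ) *ᵥ α l) 0 = 0) ∧
        ¬ φ.Irrationality U) := by
  refine ⟨hU.exists_hasNormalForm, fun P μ ν ω hN => ⟨⟨?_, ?_⟩, fun he φ hφ => ⟨?_, ?_⟩⟩⟩
  · rintro ⟨φ, hφ, hmin, -⟩ he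
    exact hN.not_isMinimal he hφ hmin
  · exact hN.isLinearPartOfMinimalFree_of_not_isExceptional hp
  · exact fun α hα => hN.lift_coord_eq_zero he hα.1
  · exact hN.not_irrationality he hφ
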